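/- Let $\mathcal X$ be a measurable space (e.g. $\mathcal X=\mathbb R$), let $P^a,P^b$ be probability measures on $\mathcal X$, and let $\mathcal F$ be a set of functions $f\colon\mathcal X\to\mathbb R$ (utility functions). For a probability measure $P$ write $Pf=\int f\,dP$, and for sample points $x_1,x_2,\dots$ let $\mathbb G_n f=\sqrt n\,\bigl(\tfrac1n\sum_{i=1}^n f(x_i)-Pf\bigr)$. Let $\ell^\infty(\mathcal F)$ be the space of bounded functions $\mathcal F\to\mathbb R$ with the supremum norm. Weak convergence $Z_k\rightsquigarrow G$ of possibly non-measurable maps $Z_k$ to a Borel measurable random element $G$ means $\mathbb E^*h(Z_k)\to\mathbb E\,h(G)$ for every bounded continuous real-valued $h$, where $\mathbb E^*$ is the outer expectation. The class $\mathcal F$ is called $P$-Donsker if its members are measurable and $P$-square-integrable, $\sup_{f\in\mathcal F}|f(x)-Pf|<\infty$ for every $x\in\mathcal X$, and the empirical process $\mathbb G_n$ of the coordinate projections on $(\mathcal X^{\mathbb N},P^{\mathbb N})$ converges weakly in $\ell^\infty(\mathcal F)$, as $n\to\infty$, to some tight Borel measurable random element. **Theorem.** Let $\mathcal F$ be both $P^a$-Donsker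 and $P^b$-Donsker. On some probability space let $Y^a_1,Y^a_2,\dots$ be i.i.d. with distribution $P^a$ and, independently of them, let $Y^b_1,Y^b_2,\dots$ be i.i.d. with distribution $P^b$. Let $n_a,n_b\to\infty$ with $n_a/n_b\to\lambda$ for a real number $\lambda$, and let $\mathbb G^a_{n_a}=\sqrt{n_a}(\mathbb P^a_{n_a}-P^a)$ and $\mathbb G^b_{n_b}=\sqrt{n_b}(\mathbb P^b_{n_b}-P^b)$ be the empirical processes of $Y^a_1,\dots,Y^a_{n_a}$ and of $Y^b_1,\dots,Y^b_{n_b}$. Then there are independent tight Borel measurable random elements $\mathbb G^a,\mathbb G^b$ of $\ell^\infty(\mathcal F)$ such that 1. $\mathbb G^a$ and $\mathbb G^b$ are a $P^a$- and a $P^b$-Brownian bridge, respectively, i.e. mean-zero Gaussian processes with covariance functions $\mathbb E[\mathbb G^a f\,\mathbb G^a g]=P^afg-P^af\,P^ag$ and $\mathbb E[\mathbb G^b f\,\mathbb G^b g]=P^bfg-P^bf\,P^bg$ for $f,g\in\mathcal F$; 2. $\mathbb G^a_{n_a}\rightsquigarrow\mathbb G^a$ and $\mathbb G^b_{n_b}\rightsquigarrow\mathbb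 G^b$ in $\ell^\infty(\mathcal F)$; 3. the convergence is joint: $(\mathbb G^a_{n_a},\mathbb G^b_{n_b})\rightsquigarrow(\mathbb G^a,\mathbb G^b)$ in $\ell^\infty(\mathcal F)\times\ell^\infty(\mathcal F)$. -/

import Mathlib

open MeasureTheory ProbabilityTheory Filter Topology
open scoped ENNReal BoundedContinuousFunction

universe u

/-- The outer expectation `E^* h` of a bounded, possibly non-measurable, map `h : Ω → ℝ`: the
infimum of `E U` over the integrable measurable majorants `U ≥ h`. -/
noncomputable def outerExpectation {Ω : Type*} [MeasurableSpace Ω] (μ : Measure Ω)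
    (h : Ω → ℝ) : ℝ :=
  sInf {r : ℝ | ∃ U : Ω → ℝ, Measurable U ∧ Integrable U μ ∧ (∀ ω, h ω ≤ U ω) ∧ r = ∫ ω, U ω ∂μ}

/-- Weak convergence (in the sense of Hoffmann-Jørgensen) along the filter `l` of arbitrary,
possibly non-measurable, maps `Z i : Ω → E` to a Borel measurable random element `G : Ω' → E`:
`E^* h(Z i) → E h(G)` for every bounded continuous `h : E → ℝ`. -/
def WeaklyConverges {Ω ι E Ω' : Type*} [MeasurableSpace Ω] [TopologicalSpace E]
    [MeasurableSpace Ω'] (μ : Measure Ω) (Z : ι → Ω → E) (l : Filter ι)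
    (ν : Measure Ω') (G : Ω' → E) : Prop :=
  Measurable[_, borel E] G ∧
    ∀ h : E →ᵇ ℝ, Tendsto (fun i => outerExpectation μ (fun ω => h (Z i ω))) l
      (𝓝 (∫ ω, h (G ω) ∂ν))

/-- `G` is a tight Borel measurable random element of `E`. -/
def IsTightBorel {E Ω' : Type*} [TopologicalSpace E] [MeasurableSpace Ω'] (ν : Measure Ω')
    (G : Ω' → E) : Prop :=
  Measurable[_, borel E] G ∧
    ∀ ε : ℝ≥0∞, 0 < ε → ∃ K : Set E, IsCompact K ∧ ν {ω | G ω ∉ K} ≤ ε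

/-- The space `ℓ^∞(F)` of bounded functions `F → ℝ`, with the supremum norm. -/
abbrev LInfty {X : Type u} (F : Set (X → ℝ)) : Type u := lp (fun _ : F => ℝ) ∞

/-- `sup_{f ∈ F} |f(x) - P f| < ∞` for every `x`. -/
def PointwiseBounded {X : Type u} [MeasurableSpace X] (P : Measure X) (F : Set (X → ℝ)) : Prop :=
  ∀ x : X, BddAbove (Set.range fun f : F => |(f : X → ℝ) x - ∫ y, (f : X → ℝ) y ∂P|)

/-- `𝔾_n f = √n (P_n f - P f)`, where `P_n f` is the average of `f` over the first `n` sample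
points `x 0, …, x (n - 1)`. -/
noncomputable def empiricalValue {X : Type u} [MeasurableSpace X] (P : Measure X)
    (x : ℕ → X) (n : ℕ) (f : X → ℝ) : ℝ :=
  √(n : ℝ) * ((n : ℝ)⁻¹ * ∑ i ∈ Finset.range n, f (x i) - ∫ y, f y ∂P)

theorem memℓp_empiricalValue {X : Type u} [MeasurableSpace X] {P : Measure X}
    {F : Set (X → ℝ)} (hF : PointwiseBounded P F) (x : ℕ → X) (n : ℕ) :
    Memℓp (fun f : F => empiricalValue P x n (f : X → ℝ)) ∞ := by
  rcases Nat.eq_zero_or_pos n with rfl | hn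
  · refine memℓp_infty ⟨0, ?_⟩
    rintro _ ⟨f, rfl⟩
    simp [empiricalValue]
  choose C hC using hF
  refine memℓp_infty ⟨√(n : ℝ) * ((n : ℝ)⁻¹ * ∑ i ∈ Finset.range n, C (x i)), ?_⟩
  rintro _ ⟨f, rfl⟩
  have hn' : (n : ℝ) ≠ 0 := by positivity
  have h : (n : ℝ)⁻¹ * ∑ i ∈ Finset.range n, (f : X → ℝ) (x i) - ∫ y, (f : X → ℝ) y ∂P
      = (n : ℝ)⁻¹ * ∑ i ∈ Finset.range n, ((f : X → ℝ) (x i) - ∫ y, (f : X → ℝ) y ∂P) := by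
    rw [Finset.sum_sub_distrib, Finset.sum_const, Finset.card_range, nsmul_eq_mul]
    field_simp
  simp only [empiricalValue, h, norm_mul, Real.norm_eq_abs, abs_inv, Nat.abs_cast,
    abs_of_nonneg (Real.sqrt_nonneg _)]
  gcongr
  refine (Finset.abs_sum_le_sum_abs _ _).trans (Finset.sum_le_sum fun i _ => ?_)
  exact hC (x i) ⟨f, rfl⟩

/-- The empirical process `𝔾_n = √n (P_n - P)`, as an element of `ℓ^∞(F)`, of the sample `x`. -/
noncomputable def empiricalProcess {X : Type u} [MeasurableSpace X] {P : Measure X}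
    {F : Set (X → ℝ)} (hF : PointwiseBounded P F) (x : ℕ → X) (n : ℕ) : LInfty F :=
  ⟨fun f : F => empiricalValue P x n (f : X → ℝ), memℓp_empiricalValue hF x n⟩

/-- `F` is a `P`-Donsker class: a class of measurable, square-integrable functions with
`sup_{f ∈ F} |f(x) - P f| < ∞` for every `x`, whose empirical process, built from the coordinate
projections on the product space `(X^ℕ, P^ℕ)`, converges weakly in `ℓ^∞(F)` to a tight Borel
measurable random element. -/
structure IsDonsker {X : Type u} [MeasurableSpace X] (P : Measure X) [IsProbabilityMeasure P]
    (F : Set (X → ℝ)) : Prop where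
  measurable : ∀ f ∈ F, Measurable f
  memLp_two : ∀ f ∈ F, MemLp f 2 P
  bounded : PointwiseBounded P F
  tight_limit : ∃ (Ω' : Type u) (_ : MeasurableSpace Ω') (ν : Measure Ω')
    (_ : IsProbabilityMeasure ν) (G : Ω' → LInfty F), IsTightBorel ν G ∧
      WeaklyConverges (Measure.infinitePi fun _ : ℕ => P)
        (fun (n : ℕ) (x : ℕ → X) => empiricalProcess bounded x n) atTop ν G

/-- `G` is a `P`-Brownian bridge on `F`: a tight Borel measurable random element of `ℓ^∞(F)` which
is a mean-zero Gaussian process with covariance function `P fg - P f P g`. -/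
structure IsBrownianBridge {X : Type u} [MeasurableSpace X] (P : Measure X) {F : Set (X → ℝ)}
    {Ω' : Type*} [MeasurableSpace Ω'] (ν : Measure Ω') (G : Ω' → LInfty F) : Prop where
  tight : IsTightBorel ν G
  gaussian : IsGaussianProcess (fun (f : F) (ω : Ω') => G ω f) ν
  mean_zero : ∀ f : F, ∫ ω, G ω f ∂ν = 0
  covariance : ∀ f g : F, ∫ ω, G ω f * G ω g ∂ν =
    ∫ y, (f : X → ℝ) y * (g : X → ℝ) y ∂P
      - (∫ y, (f : X → ℝ) y ∂P) * ∫ y, (g : X → ℝ) y ∂P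

/-! Each Donsker hypothesis supplies a tight limit. The central limit theorem identifies its law:
evaluation at finitely many functions is continuous and the corresponding empirical averages are
measurable, so every finite linear combination of coordinates of the limit is centered Gaussian with
the variance of the same combination under `P`. Cramér–Wold gives Gaussianity, polarization the
covariance (`IsDonsker.map_sum_eq_gaussianReal`, `IsDonsker.isBrownianBridge`).

Realizing the two limits as coordinates on a product space makes them independent. Joint convergence
(`WeaklyConverges.prodMk`) cannot use Fubini, since the maps need not be measurable. Instead a
nonnegative bounded continuous function on the product is dominated by a finite sum of products of
nonnegative functions, nearly sharp on a compact rectangle carrying most of the limit's mass. Outer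
expectation is subadditive and is submultiplicative on independent factors, so the marginal
convergences bound the limsup; applying the bound to both `h` and `-h`, shifted to be nonnegative,
yields convergence. -/

/-! ### Calculus of outer expectations. -/

section OuterExpectation

variable {Ω : Type*} [MeasurableSpace Ω] {μ : Measure Ω}

/-- The lower bound `C` keeps the set of majorant integrals bounded below, so that `sInf` is a
genuine infimum and not the default value `0`. -/
theorem outerExpectation_le_integral [IsProbabilityMeasure μ] {h U : Ω → ℝ} {C : ℝ}
    (hC : ∀ ω, C ≤ h ω) (hU : Measurable U) (hUi : Integrable U μ) (hle : ∀ ω, h ω ≤ U ω) :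
    outerExpectation μ h ≤ ∫ ω, U ω ∂μ := by
  refine csInf_le ⟨C, ?_⟩ ⟨U, hU, hUi, hle, rfl⟩
  rintro _ ⟨V, -, hVi, hV, rfl⟩
  simpa using integral_mono (integrable_const C) hVi fun ω => (hC ω).trans (hV ω)

theorem exists_majorant_integral_lt [IsProbabilityMeasure μ] {h : Ω → ℝ} {C : ℝ}
    (hC : ∀ ω, h ω ≤ C) {r : ℝ} (hr : outerExpectation μ h < r) :
    ∃ U : Ω → ℝ, Measurable U ∧ Integrable U μ ∧ (∀ ω, h ω ≤ U ω) ∧ ∫ ω, U ω ∂μ < r := by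
  obtain ⟨_, ⟨U, hU, hUi, hle, rfl⟩, hlt⟩ := exists_lt_of_csInf_lt (by
    exact ⟨_, fun _ => C, measurable_const, integrable_const C, hC, rfl⟩) hr
  exact ⟨U, hU, hUi, hle, hlt⟩

theorem outerExpectation_nonneg [IsProbabilityMeasure μ] {h : Ω → ℝ} {C : ℝ}
    (h0 : ∀ ω, 0 ≤ h ω) (hC : ∀ ω, h ω ≤ C) : 0 ≤ outerExpectation μ h := by
  by_contra! hlt
  obtain ⟨U, -, -, hle, hlt⟩ := exists_majorant_integral_lt hC hlt
  exact hlt.not_ge (integral_nonneg fun ω => (h0 ω).trans (hle ω))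

theorem outerExpectation_mono [IsProbabilityMeasure μ] {h k : Ω → ℝ} {C D : ℝ}
    (hC : ∀ ω, C ≤ h ω) (hD : ∀ ω, k ω ≤ D) (hk : ∀ ω, h ω ≤ k ω) :
    outerExpectation μ h ≤ outerExpectation μ k := by
  refine le_of_forall_gt fun r hr => ?_
  obtain ⟨U, hU, hUi, hle, hlt⟩ := exists_majorant_integral_lt hD hr
  exact (outerExpectation_le_integral hC hU hUi fun ω => (hk ω).trans (hle ω)).trans_lt hlt

theorem outerExpectation_eq_integral [IsProbabilityMeasure μ] {h : Ω → ℝ} {C : ℝ}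
    (hm : Measurable h) (hC : ∀ ω, |h ω| ≤ C) : outerExpectation μ h = ∫ ω, h ω ∂μ := by
  have hi : Integrable h μ :=
    Integrable.of_bound hm.aestronglyMeasurable C (Eventually.of_forall hC)
  refine le_antisymm
    (outerExpectation_le_integral (fun ω => (abs_le.1 (hC ω)).1) hm hi fun _ => le_rfl) ?_
  refine le_of_forall_gt fun r hr => ?_
  obtain ⟨U, -, hUi, hle, hlt⟩ :=
    exists_majorant_integral_lt (fun ω => (abs_le.1 (hC ω)).2) hr
  exact (integral_mono hi hUi hle).trans_lt hlt

theorem outerExpectation_add_const [IsProbabilityMeasure μ] {h : Ω → ℝ} {C : ℝ}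
    (hC : ∀ ω, |h ω| ≤ C) (c : ℝ) :
    outerExpectation μ h + c ≤ outerExpectation μ fun ω => h ω + c := by
  refine le_of_forall_gt fun r hr => ?_
  obtain ⟨U, hU, hUi, hle, hlt⟩ :=
    exists_majorant_integral_lt (C := C + c) (fun ω => by linarith [(abs_le.1 (hC ω)).2]) hr
  have := outerExpectation_le_integral (fun ω => (abs_le.1 (hC ω)).1) (hU.sub_const c)
    (hUi.sub (integrable_const c)) (fun ω => le_sub_iff_add_le.2 (hle ω))
  rw [integral_sub hUi (integrable_const c)] at this
  simp only [integral_const, probReal_univ, one_smul] at this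
  linarith

/-- Inner expectation is at most outer expectation. This turns an upper bound for `-h` into a lower
bound for `h`, replacing the missing linearity. -/
theorem neg_outerExpectation_neg_le [IsProbabilityMeasure μ] {h : Ω → ℝ} {C : ℝ}
    (hC : ∀ ω, |h ω| ≤ C) : -outerExpectation μ (fun ω => -h ω) ≤ outerExpectation μ h := by
  refine le_of_forall_gt fun r hr => ?_
  obtain ⟨U, -, hUi, hU, hlt⟩ :=
    exists_majorant_integral_lt (fun ω => (abs_le.1 (hC ω)).2) hr
  refine lt_of_le_of_lt (neg_le.1 (le_of_forall_gt fun s hs => ?_)) hlt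
  obtain ⟨V, -, hVi, hV, hlt'⟩ := exists_majorant_integral_lt (C := C)
    (fun ω => neg_le.1 (abs_le.1 (hC ω)).1) hs
  refine lt_of_le_of_lt ?_ hlt'
  rw [← integral_neg]
  exact integral_mono hUi.neg hVi fun ω => (neg_le_neg (hU ω)).trans (hV ω)

/-- Majorants pull back along `A`, but a majorant on `Ω` need not factor through `A`, so only one
inequality is available in general. It suffices because weak convergence is reduced to upper bounds.
-/
theorem outerExpectation_comp_le {α : Type*} [MeasurableSpace α] {P : Measure α}
    [IsProbabilityMeasure P] [IsProbabilityMeasure μ] {A : Ω → α} (hA : MeasurePreserving A μ P)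
    {h : α → ℝ} {C : ℝ} (hC : ∀ a, |h a| ≤ C) :
    outerExpectation μ (fun ω => h (A ω)) ≤ outerExpectation P h := by
  refine le_of_forall_gt fun r hr => ?_
  obtain ⟨U, hU, hUi, hle, hlt⟩ :=
    exists_majorant_integral_lt (fun ω => (abs_le.1 (hC ω)).2) hr
  refine (outerExpectation_le_integral (fun ω => (abs_le.1 (hC (A ω))).1)
    (hU.comp hA.measurable) (hA.integrable_comp_of_integrable hUi) fun ω => hle (A ω)).trans_lt ?_
  rw [← hA.map_eq, integral_map hA.measurable.aemeasurable hU.aestronglyMeasurable] at hlt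
  exact hlt

theorem outerExpectation_add_le [IsProbabilityMeasure μ] {h k : Ω → ℝ} {C D : ℝ}
    (hC : ∀ ω, |h ω| ≤ C) (hD : ∀ ω, |k ω| ≤ D) :
    outerExpectation μ (fun ω => h ω + k ω) ≤ outerExpectation μ h + outerExpectation μ k := by
  refine le_of_forall_pos_le_add fun ε hε => ?_
  obtain ⟨U, hU, hUi, hUle, hUlt⟩ := exists_majorant_integral_lt
    (fun ω => (abs_le.1 (hC ω)).2) (lt_add_of_pos_right (outerExpectation μ h) (half_pos hε))
  obtain ⟨V, hV, hVi, hVle, hVlt⟩ := exists_majorant_integral_lt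
    (fun ω => (abs_le.1 (hD ω)).2) (lt_add_of_pos_right (outerExpectation μ k) (half_pos hε))
  have := outerExpectation_le_integral (C := -C + -D)
    (fun ω => add_le_add (abs_le.1 (hC ω)).1 (abs_le.1 (hD ω)).1) (hU.add hV) (hUi.add hVi)
    (fun ω => add_le_add (hUle ω) (hVle ω))
  simp only [Pi.add_apply, integral_add hUi hVi] at this
  linarith

theorem outerExpectation_sum_le [IsProbabilityMeasure μ] {J : Type*} (s : Finset J)
    {h : J → Ω → ℝ} {C : J → ℝ} (hC : ∀ j ω, |h j ω| ≤ C j) :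
    outerExpectation μ (fun ω => ∑ j ∈ s, h j ω) ≤ ∑ j ∈ s, outerExpectation μ (h j) := by
  classical
  induction s using Finset.induction_on with
  | empty =>
    simp only [Finset.sum_empty]
    rw [outerExpectation_eq_integral (C := 0) measurable_const (by simp)]
    simp
  | insert a s ha ih =>
    simp only [Finset.sum_insert ha]
    refine (outerExpectation_add_le (D := ∑ j ∈ s, C j) (hC a) fun ω => ?_).trans
      (add_le_add le_rfl ih)
    exact (Finset.abs_sum_le_sum_abs _ _).trans (Finset.sum_le_sum fun j _ => hC j ω)

/-- Outer expectations of products of independent nonnegative maps are submultiplicative. -/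
theorem outerExpectation_const_mul_mul_le {α β : Type*} [MeasurableSpace α] [MeasurableSpace β]
    {P : Measure α} {Q : Measure β} [IsProbabilityMeasure P] [IsProbabilityMeasure Q]
    [IsProbabilityMeasure μ] {A : Ω → α} {B : Ω → β} (hA : MeasurePreserving A μ P)
    (hB : MeasurePreserving B μ Q) (hAB : IndepFun A B μ) {h : α → ℝ} {k : β → ℝ} {C D c : ℝ}
    (hc : 0 ≤ c) (h0 : ∀ a, 0 ≤ h a) (hC : ∀ a, h a ≤ C) (k0 : ∀ b, 0 ≤ k b)
    (hD : ∀ b, k b ≤ D) :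
    outerExpectation μ (fun ω => c * (h (A ω) * k (B ω)))
      ≤ c * (outerExpectation P h * outerExpectation Q k) := by
  -- Near-optimal measurable majorants `U` and `V` become independent after composition with `A` and
  -- `B`, so the integral of their product factors.
  have key : ∀ ε > 0, outerExpectation μ (fun ω => c * (h (A ω) * k (B ω)))
      ≤ c * ((outerExpectation P h + ε) * (outerExpectation Q k + ε)) := fun ε hε => by
    obtain ⟨U, hU, hUi, hUle, hUlt⟩ := exists_majorant_integral_lt hC
      (lt_add_of_pos_right (outerExpectation P h) hε)
    obtain ⟨V, hV, hVi, hVle, hVlt⟩ := exists_majorant_integral_lt hD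
      (lt_add_of_pos_right (outerExpectation Q k) hε)
    have hUA := hA.integrable_comp_of_integrable hUi
    have hVB := hB.integrable_comp_of_integrable hVi
    have hind : IndepFun (U ∘ A) (V ∘ B) μ := hAB.comp hU hV
    have hprod : Integrable (fun ω => U (A ω) * V (B ω)) μ := hind.integrable_mul hUA hVB
    refine (outerExpectation_le_integral (C := 0) (U := fun ω => c * (U (A ω) * V (B ω)))
      (fun ω => by have := h0 (A ω); have := k0 (B ω); positivity) ?_ (hprod.const_mul c)
      fun ω => ?_).trans ?_
    · exact ((hU.comp hA.measurable).mul (hV.comp hB.measurable)).const_mul c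
    · exact mul_le_mul_of_nonneg_left
        (mul_le_mul (hUle _) (hVle _) (k0 _) ((h0 _).trans (hUle _))) hc
    · have hint : ∫ ω, U (A ω) * V (B ω) ∂μ = (∫ a, U a ∂P) * ∫ b, V b ∂Q := by
        rw [← hA.map_eq, ← hB.map_eq, integral_map hA.measurable.aemeasurable
          hU.aestronglyMeasurable, integral_map hB.measurable.aemeasurable
          hV.aestronglyMeasurable]
        exact hind.integral_fun_mul_eq_mul_integral hUA.aestronglyMeasurable
          hVB.aestronglyMeasurable
      rw [integral_const_mul, hint]
      refine mul_le_mul_of_nonneg_left (mul_le_mul hUlt.le hVlt.le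
        (integral_nonneg fun b => (k0 b).trans (hVle b)) ?_) hc
      exact add_nonneg (outerExpectation_nonneg h0 hC) hε.le
  have hlim : Tendsto (fun ε : ℝ => c * ((outerExpectation P h + ε) * (outerExpectation Q k + ε)))
      (𝓝[>] 0) (𝓝 (c * ((outerExpectation P h + 0) * (outerExpectation Q k + 0)))) :=
    (Continuous.tendsto (by fun_prop) 0).mono_left nhdsWithin_le_nhds
  simpa using ge_of_tendsto hlim (eventually_mem_nhdsWithin.mono fun ε hε => key ε hε)

end OuterExpectation

/-! ### Weak convergence and tightness of non-measurable maps. -/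

section WeakConvergence

variable {Ω ι E Ω' : Type*} [MeasurableSpace Ω] [TopologicalSpace E] [MeasurableSpace Ω']
  {μ : Measure Ω} {ν : Measure Ω'} {Z : ι → Ω → E} {l : Filter ι} {G : Ω' → E}

theorem BoundedContinuousFunction.integrable_comp_borel [IsFiniteMeasure ν]
    (hG : Measurable[_, borel E] G) (h : E →ᵇ ℝ) : Integrable (fun ω => h (G ω)) ν := by
  let _ : MeasurableSpace E := borel E
  have _ : BorelSpace E := ⟨rfl⟩
  exact Integrable.of_bound (h.continuous.measurable.comp hG).aestronglyMeasurable ‖h‖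
    (Eventually.of_forall fun ω => h.norm_coe_le_norm _)

/-- To prove weak convergence it suffices to bound the limits superior of the outer expectations
of nonnegative bounded continuous functions. -/
theorem weaklyConverges_of_eventually_le [IsProbabilityMeasure μ] [IsProbabilityMeasure ν]
    (hG : Measurable[_, borel E] G)
    (H : ∀ h : E →ᵇ ℝ, (∀ x, 0 ≤ h x) → ∀ ε > 0, ∀ᶠ i in l,
      outerExpectation μ (fun ω => h (Z i ω)) ≤ ∫ ω, h (G ω) ∂ν + ε) :
    WeaklyConverges μ Z l ν G := by
  have H' : ∀ h : E →ᵇ ℝ, ∀ ε > 0, ∀ᶠ i in l,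
      outerExpectation μ (fun ω => h (Z i ω)) ≤ ∫ ω, h (G ω) ∂ν + ε := fun h ε hε => by
    have hb : ∀ x, |h x| ≤ ‖h‖ := fun x => h.norm_coe_le_norm x
    -- Shifting by `‖h‖` makes the test function nonnegative; `outerExpectation_add_const` undoes
    -- the shift.
    filter_upwards [H (h + BoundedContinuousFunction.const E ‖h‖)
      (fun x => by simpa using neg_le_iff_add_nonneg.1 (abs_le.1 (hb x)).1) ε hε] with i hi
    have h1 := outerExpectation_add_const (μ := μ) (fun ω => hb (Z i ω)) ‖h‖
    simp only [BoundedContinuousFunction.coe_add, BoundedContinuousFunction.const_apply,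
      Pi.add_apply] at hi
    rw [integral_add (h.integrable_comp_borel hG) (integrable_const _)] at hi
    simp only [integral_const, probReal_univ, one_smul] at hi
    linarith
  refine ⟨hG, fun h => Metric.tendsto_nhds.2 fun ε hε => ?_⟩
  filter_upwards [H' h (ε / 2) (half_pos hε), H' (-h) (ε / 2) (half_pos hε)] with i h1 h2
  have h3 := neg_outerExpectation_neg_le (μ := μ) (h := fun ω => h (Z i ω))
    (fun ω => h.norm_coe_le_norm (Z i ω))
  simp only [BoundedContinuousFunction.coe_neg, Pi.neg_apply, integral_neg] at h2
  rw [Real.dist_eq, abs_lt]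
  constructor <;> linarith

theorem WeaklyConverges.eventually_le (hZ : WeaklyConverges μ Z l ν G) (h : E →ᵇ ℝ) {ε : ℝ}
    (hε : 0 < ε) : ∀ᶠ i in l, outerExpectation μ (fun ω => h (Z i ω)) ≤ ∫ ω, h (G ω) ∂ν + ε :=
  ((hZ.2 h).eventually_lt_const (lt_add_of_pos_right _ hε)).mono fun _ => le_of_lt

theorem WeaklyConverges.comp_tendsto {κ : Type*} {m : Filter κ} {u : κ → ι}
    (hZ : WeaklyConverges μ Z l ν G) (hu : Tendsto u m l) :
    WeaklyConverges μ (fun k => Z (u k)) m ν G :=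
  ⟨hZ.1, fun h => (hZ.2 h).comp hu⟩

/-- Weak convergence is inherited by the composition with a measure preserving map. -/
theorem WeaklyConverges.comp_measurePreserving {α : Type*} [MeasurableSpace α] {P : Measure α}
    [IsProbabilityMeasure P] [IsProbabilityMeasure μ] [IsProbabilityMeasure ν] {z : ι → α → E}
    (hz : WeaklyConverges P z l ν G) {A : Ω → α} (hA : MeasurePreserving A μ P) :
    WeaklyConverges μ (fun i ω => z i (A ω)) l ν G :=
  weaklyConverges_of_eventually_le hz.1 fun h _ _ hε => (hz.eventually_le h hε).mono fun i hi =>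
    (outerExpectation_comp_le hA fun a => h.norm_coe_le_norm (z i a)).trans hi

/-- Only the law of the limit matters, so it can be moved to a larger probability space; this is how
both limits come to live on one product space. -/
theorem WeaklyConverges.limit_comp_measurePreserving {Ω'' : Type*} [MeasurableSpace Ω'']
    {ρ : Measure Ω''} {p : Ω'' → Ω'} (hZ : WeaklyConverges μ Z l ν G)
    (hp : MeasurePreserving p ρ ν) : WeaklyConverges μ Z l ρ fun ω => G (p ω) := by
  let _ : MeasurableSpace E := borel E
  have _ : BorelSpace E := ⟨rfl⟩
  refine ⟨hZ.1.comp hp.measurable, fun h => ?_⟩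
  convert hZ.2 h using 2
  rw [← hp.map_eq, integral_map hp.measurable.aemeasurable]
  exact (h.continuous.measurable.comp hZ.1).aestronglyMeasurable

theorem WeaklyConverges.limit_congr (hZ : WeaklyConverges μ Z l ν G) {G' : Ω' → E}
    (hG' : Measurable[_, borel E] G') (h : G =ᵐ[ν] G') : WeaklyConverges μ Z l ν G' :=
  ⟨hG', fun k => by
    rw [← integral_congr_ae (h.mono fun ω hω => congrArg k hω)]
    exact hZ.2 k⟩

theorem IsTightBorel.comp_measurePreserving {Ω'' : Type*} [MeasurableSpace Ω''] [T2Space E]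
    {ρ : Measure Ω''} {p : Ω'' → Ω'} (hG : IsTightBorel ν G) (hp : MeasurePreserving p ρ ν) :
    IsTightBorel ρ fun ω => G (p ω) := by
  let _ : MeasurableSpace E := borel E
  have _ : BorelSpace E := ⟨rfl⟩
  refine ⟨hG.1.comp hp.measurable, fun ε hε => ?_⟩
  obtain ⟨K, hK, hle⟩ := hG.2 ε hε
  refine ⟨K, hK, ?_⟩
  have hm : MeasurableSet {ω | G ω ∉ K} := hG.1 hK.measurableSet.compl
  exact (hp.measure_preimage hm.nullMeasurableSet).trans_le hle

theorem IsTightBorel.congr {G' : Ω' → E} (hG : IsTightBorel ν G)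
    (hG' : Measurable[_, borel E] G') (h : G =ᵐ[ν] G') : IsTightBorel ν G' :=
  ⟨hG', fun ε hε => (hG.2 ε hε).imp fun K hK => ⟨hK.1, (measure_congr (h.mono fun ω hω => by
    change (G ω ∉ K) = (G' ω ∉ K); rw [hω])).symm.trans_le hK.2⟩⟩

/-- A tight random element agrees almost surely with one whose values lie in a separable set. -/
theorem IsTightBorel.exists_ae_eq_isSeparable {E : Type*} [MetricSpace E] [Nonempty E]
    {G : Ω' → E} (hG : IsTightBorel ν G) :
    ∃ G' : Ω' → E, Measurable[_, borel E] G' ∧ G =ᵐ[ν] G' ∧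
      ∃ S : Set E, TopologicalSpace.IsSeparable S ∧ ∀ ω, G' ω ∈ S := by
  classical
  let _ : MeasurableSpace E := borel E
  have _ : BorelSpace E := ⟨rfl⟩
  choose K hK hle using fun n : ℕ => hG.2 ((n : ℝ≥0∞) + 1)⁻¹ (by simp)
  let e : E := Classical.arbitrary E
  have hS : MeasurableSet (⋃ n, K n) := .iUnion fun n => (hK n).measurableSet
  have hmeas : MeasurableSet {ω | G ω ∈ ⋃ n, K n} := hG.1 hS
  -- The σ-compact union carries almost all of the law, so redirecting the remaining values to one
  -- point changes `G` only on a null set.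
  refine ⟨fun ω => if G ω ∈ ⋃ n, K n then G ω else e, .ite hmeas hG.1 measurable_const, ?_,
    (⋃ n, K n) ∪ {e}, ?_, fun ω => ?_⟩
  · have : ∀ᵐ ω ∂ν, G ω ∈ ⋃ n, K n := by
      refine le_antisymm (ge_of_tendsto' (x := atTop) (f := fun n : ℕ => ((n : ℝ≥0∞) + 1)⁻¹) ?_ fun n => ?_)
        bot_le
      · simpa using (tendsto_add_atTop_iff_nat (f := fun n : ℕ => (n : ℝ≥0∞)⁻¹) 1).2
          ENNReal.tendsto_inv_nat_nhds_zero
      · refine (measure_mono (t := {ω | G ω ∉ K n}) fun ω hω hn => ?_).trans (hle n)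
        exact hω (Set.mem_iUnion.2 ⟨n, hn⟩)
    filter_upwards [this] with ω hω
    rw [if_pos hω]
  · exact (TopologicalSpace.IsSeparable.iUnion fun n => (hK n).isSeparable).union
      (Set.finite_singleton e).isSeparable
  · dsimp only
    split_ifs with h
    exacts [Or.inl h, Or.inr rfl]

end WeakConvergence

/-! ### Joint convergence of independent maps. -/

section Joint

/-- A finite continuous partition of unity of a metric space, all but one of whose members have
small support near a compact set, on which the exceptional one vanishes. -/
theorem IsCompact.exists_partition_subordinate_ball {E : Type*} [MetricSpace E] {K : Set E}
    (hK : IsCompact K) {δ : ℝ} (hδ : 0 < δ) :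
    ∃ (t : Finset E) (φ : Option t → E →ᵇ ℝ), (∀ i ∈ t, i ∈ K) ∧ (∀ j x, 0 ≤ φ j x) ∧
      (∀ x, ∑ j, φ j x = 1) ∧ (∀ x ∈ K, φ none x = 0) ∧
      ∀ (i : t) x, φ (some i) x ≠ 0 → dist (i : E) x < δ := by
  obtain ⟨t, htK, htf, ht⟩ := hK.finite_cover_balls hδ
  lift t to Finset E using htf
  obtain ⟨f, hf⟩ := PartitionOfUnity.exists_isSubordinate_of_locallyFinite hK.isClosed
    (fun i : t => Metric.ball (i : E) δ) (fun i => Metric.isOpen_ball) (locallyFinite_of_finite _)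
    (ht.trans fun x hx => by simpa using hx)
  have hsum : ∀ x, ∑ᶠ i, f i x = ∑ i, f i x := fun x => finsum_eq_sum_of_fintype _
  have hle : ∀ x, ∑ i, f i x ≤ 1 := fun x => hsum x ▸ f.sum_le_one x
  have hle' : ∀ i x, f i x ≤ 1 := fun i x =>
    (Finset.single_le_sum (fun i _ => f.nonneg i x) (Finset.mem_univ i)).trans (hle x)
  let ψ : t → E →ᵇ ℝ := fun i => BoundedContinuousFunction.ofNormedAddCommGroup (f i)
    (f i).continuous 1 fun x => by rw [Real.norm_of_nonneg (f.nonneg i x)]; exact hle' i x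
  have hnone : ∀ x, (1 - ∑ i, ψ i : E →ᵇ ℝ) x = 1 - ∑ i, f i x := fun x => by
    simp [ψ, BoundedContinuousFunction.coe_sum]
  refine ⟨t, fun j => j.elim (1 - ∑ i, ψ i) ψ, fun i hi => htK hi, ?_, fun x => ?_, fun x hx => ?_,
    fun i x hx => ?_⟩
  · rintro (_ | i) x
    · exact (hnone x).symm ▸ sub_nonneg.2 (hle x)
    · exact f.nonneg i x
  · rw [Fintype.sum_option]
    simp only [Option.elim, hnone]
    exact sub_add_cancel 1 (∑ i, f i x)
  · have := f.sum_eq_one hx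
    rw [hsum] at this
    simp only [Option.elim, hnone, this, sub_self]
  · have : x ∈ tsupport (f i) := subset_tsupport _ hx
    simpa [dist_comm] using hf i this

/-- Approximation of a bounded nonnegative continuous function of two variables from above by a
finite sum of products, up to `ε` on a product of two compact sets. -/
theorem BoundedContinuousFunction.exists_le_sum_mul {E E' : Type*} [MetricSpace E] [MetricSpace E']
    (h : E × E' →ᵇ ℝ) (h0 : ∀ p, 0 ≤ h p) {K : Set E} {K' : Set E'} (hK : IsCompact K)
    (hK' : IsCompact K') {ε : ℝ} (hε : 0 < ε) :
    ∃ (s : Finset E) (t : Finset E') (φ : Option s → E →ᵇ ℝ) (ψ : Option t → E' →ᵇ ℝ)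
      (c : Option s × Option t → ℝ), (∀ i x, 0 ≤ φ i x) ∧ (∀ j y, 0 ≤ ψ j y) ∧ (∀ p, 0 ≤ c p) ∧
      (∀ x y, h (x, y) ≤ ∑ p, c p * (φ p.1 x * ψ p.2 y)) ∧
      (∀ x y, ∑ p, c p * (φ p.1 x * ψ p.2 y) ≤ ‖h‖ + ε) ∧
      ∀ x ∈ K, ∀ y ∈ K', ∑ p, c p * (φ p.1 x * ψ p.2 y) ≤ h (x, y) + ε := by
  have hM : ∀ p, h p ≤ ‖h‖ := h.apply_le_norm
  -- Compactness gives a `δ` valid when only one of the two points lies in `K ×ˢ K'`: the ball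
  -- centers will lie there, while `(x, y)` is arbitrary.
  obtain ⟨δ, hδ, hunif⟩ := Metric.mem_uniformity_dist.1
    ((hK.prod hK').uniformContinuousAt_of_continuousAt h
      (fun a _ => h.continuous.continuousAt) (Metric.dist_mem_uniformity (half_pos hε)))
  obtain ⟨s, φ, hs, φ0, φ1, φK, φδ⟩ := hK.exists_partition_subordinate_ball hδ
  obtain ⟨t, ψ, ht, ψ0, ψ1, ψK, ψδ⟩ := hK'.exists_partition_subordinate_ball hδ
  have hnear : ∀ (i : s) (j : t) x y, φ (some i) x * ψ (some j) y ≠ 0 →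
      |h (i, j) - h (x, y)| < ε / 2 := fun i j x y hij =>
    hunif (show dist ((i : E), (j : E')) (x, y) < δ from max_lt (φδ i x (left_ne_zero_of_mul hij))
      (ψδ j y (right_ne_zero_of_mul hij))) ⟨hs i i.2, ht j j.2⟩
  -- Where both factors are localized, `h` varies by less than `ε / 2` from its value at the
  -- centers, so adding `ε / 2` dominates it at a cost below `ε`. The terms involving `none` take
  -- the crude bound `‖h‖`, harmless because they vanish on `K ×ˢ K'`.
  let c : Option s × Option t → ℝ := fun p => match p with
    | (some i, some j) => h (i, j) + ε / 2
    | _ => ‖h‖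
  have hc : ∀ p, 0 ≤ c p ∧ c p ≤ ‖h‖ + ε := by
    rintro ⟨_ | i, _ | j⟩ <;> simp only [c]
    iterate 3 exact ⟨norm_nonneg _, by linarith⟩
    exact ⟨by linarith [h0 (i, j)], by linarith [hM (i, j)]⟩
  have hw0 : ∀ (p : Option s × Option t) x y, 0 ≤ φ p.1 x * ψ p.2 y := fun p x y =>
    mul_nonneg (φ0 _ _) (ψ0 _ _)
  have hw1 : ∀ x y r, ∑ p : Option s × Option t, r * (φ p.1 x * ψ p.2 y) = r := fun x y r => by
    rw [← Finset.mul_sum, Fintype.sum_prod_type]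
    simp only
    rw [← Fintype.sum_mul_sum, φ1, ψ1]
    simp
  refine ⟨s, t, φ, ψ, c, φ0, ψ0, fun p => (hc p).1, fun x y => ?_, fun x y => ?_,
    fun x hx y hy => ?_⟩
  · rw [← hw1 x y (h (x, y))]
    refine Finset.sum_le_sum fun p _ => ?_
    by_cases hp : φ p.1 x * ψ p.2 y = 0
    · simp [hp]
    refine mul_le_mul_of_nonneg_right ?_ (hw0 p x y)
    rcases p with ⟨_ | i, _ | j⟩ <;> simp only [c]
    iterate 3 exact hM _
    linarith [(abs_lt.1 (hnear i j x y hp)).1]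
  · rw [← hw1 x y (‖h‖ + ε)]
    exact Finset.sum_le_sum fun p _ => mul_le_mul_of_nonneg_right (hc p).2 (hw0 p x y)
  · rw [← hw1 x y (h (x, y) + ε)]
    refine Finset.sum_le_sum fun p _ => ?_
    by_cases hp : φ p.1 x * ψ p.2 y = 0
    · simp [hp]
    refine mul_le_mul_of_nonneg_right ?_ (hw0 p x y)
    rcases p with ⟨_ | i, _ | j⟩ <;> simp only [c]
    · exact absurd (by simp [φK x hx]) hp
    · exact absurd (by simp [φK x hx]) hp
    · exact absurd (by simp [ψK y hy]) hp
    · linarith [(abs_lt.1 (hnear i j x y hp)).2]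

/-- Joint weak convergence of independent, possibly non-measurable, maps with tight limits. -/
theorem WeaklyConverges.prodMk {Ω ι α β E E' Ωa Ωb : Type*} [MeasurableSpace Ω]
    [MeasurableSpace α] [MeasurableSpace β] [MetricSpace E] [MetricSpace E'] [MeasurableSpace Ωa]
    [MeasurableSpace Ωb] {μ : Measure Ω} {P : Measure α} {Q : Measure β} {νa : Measure Ωa}
    {νb : Measure Ωb} [IsProbabilityMeasure μ] [IsProbabilityMeasure P] [IsProbabilityMeasure Q]
    [IsProbabilityMeasure νa] [IsProbabilityMeasure νb] {A : Ω → α} {B : Ω → β}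
    (hA : MeasurePreserving A μ P) (hB : MeasurePreserving B μ Q) (hAB : IndepFun A B μ)
    {l : Filter ι} {za : ι → α → E} {zb : ι → β → E'} {Ga : Ωa → E} {Gb : Ωb → E'}
    (hza : WeaklyConverges P za l νa Ga) (hzb : WeaklyConverges Q zb l νb Gb)
    (ha : IsTightBorel νa Ga) (hb : IsTightBorel νb Gb)
    (hG : Measurable[_, borel (E × E')] fun p : Ωa × Ωb => (Ga p.1, Gb p.2)) :
    WeaklyConverges μ (fun i ω => (za i (A ω), zb i (B ω))) l (νa.prod νb)
      fun p => (Ga p.1, Gb p.2) := by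
  refine weaklyConverges_of_eventually_le hG fun h h0 ε hε => ?_
  let _ : MeasurableSpace E := borel E
  have _ : BorelSpace E := ⟨rfl⟩
  let _ : MeasurableSpace E' := borel E'
  have _ : BorelSpace E' := ⟨rfl⟩
  -- Error budget: `η ≤ ε / 4` on the compact rectangle, and `M * (ε / (4 * M)) = ε / 4` for each of
  -- the two exceptional sets, in total `3 * ε / 4 < ε`. As `η ≤ 1`, `M` bounds the dominating sum
  -- everywhere.
  set M := ‖h‖ + 1
  have hM : 0 < M := by positivity
  set η := min 1 (ε / 4)
  have hη : 0 < η := by positivity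
  have hη1 : η ≤ 1 := min_le_left _ _
  have hη4 : η ≤ ε / 4 := min_le_right _ _
  have hpos : 0 < ε / (4 * M) := by positivity
  obtain ⟨K, hK, hKle⟩ := ha.2 (ENNReal.ofReal (ε / (4 * M))) (by simpa using hpos)
  obtain ⟨K', hK', hKle'⟩ := hb.2 (ENNReal.ofReal (ε / (4 * M))) (by simpa using hpos)
  obtain ⟨s, t, φ, ψ, c, φ0, ψ0, c0, hle, hleM, hleK⟩ := h.exists_le_sum_mul h0 hK hK' hη
  set H : E × E' → ℝ := fun q => ∑ p, c p * (φ p.1 q.1 * ψ p.2 q.2) with hH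
  have hbound : ∀ p x y, |c p * (φ p.1 x * ψ p.2 y)| ≤ c p * (‖φ p.1‖ * ‖ψ p.2‖) := fun p x y => by
    rw [abs_of_nonneg (mul_nonneg (c0 p) (mul_nonneg (φ0 _ _) (ψ0 _ _)))]
    exact mul_le_mul_of_nonneg_left (mul_le_mul ((φ p.1).apply_le_norm x)
      ((ψ p.2).apply_le_norm y) (ψ0 _ _) (norm_nonneg _)) (c0 p)
  have hupper : ∀ i, outerExpectation μ (fun ω => h (za i (A ω), zb i (B ω))) ≤
      ∑ p, c p * (outerExpectation P (fun a => φ p.1 (za i a)) *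
        outerExpectation Q fun b => ψ p.2 (zb i b)) := fun i => by
    refine (outerExpectation_mono (C := 0) (D := M) (fun ω => h0 _) (fun ω => ?_)
      fun ω => hle _ _).trans ((outerExpectation_sum_le Finset.univ fun p ω => hbound p _ _).trans
        (Finset.sum_le_sum fun p _ => ?_))
    · exact (hleM _ _).trans (by linarith)
    · exact outerExpectation_const_mul_mul_le hA hB hAB (h := fun a => φ p.1 (za i a))
        (k := fun b => ψ p.2 (zb i b)) (c0 p)
        (fun a => φ0 _ _) (fun a => (φ p.1).apply_le_norm _) (fun b => ψ0 _ _)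
        fun b => (ψ p.2).apply_le_norm _
  have hlim : Tendsto (fun i => ∑ p, c p * (outerExpectation P (fun a => φ p.1 (za i a)) *
        outerExpectation Q fun b => ψ p.2 (zb i b))) l
      (𝓝 (∑ p, c p * ((∫ ω, φ p.1 (Ga ω) ∂νa) * ∫ ω, ψ p.2 (Gb ω) ∂νb))) :=
    tendsto_finsetSum _ fun p _ => ((hza.2 (φ p.1)).mul (hzb.2 (ψ p.2))).const_mul (c p)
  have hprodi : ∀ p, Integrable (fun ω : Ωa × Ωb => c p * (φ p.1 (Ga ω.1) * ψ p.2 (Gb ω.2)))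
      (νa.prod νb) := fun p =>
    (((φ p.1).integrable_comp_borel ha.1).mul_prod
      ((ψ p.2).integrable_comp_borel hb.1)).const_mul (c p)
  have hHint : ∑ p, c p * ((∫ ω, φ p.1 (Ga ω) ∂νa) * ∫ ω, ψ p.2 (Gb ω) ∂νb)
      = ∫ ω, H (Ga ω.1, Gb ω.2) ∂(νa.prod νb) := by
    simp only [hH]
    rw [integral_finsetSum _ fun p _ => hprodi p]
    refine Finset.sum_congr rfl fun p _ => ?_
    rw [integral_const_mul, integral_prod_mul (fun ω => φ p.1 (Ga ω)) fun ω => ψ p.2 (Gb ω)]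
  have hSa : MeasurableSet {ω : Ωa × Ωb | Ga ω.1 ∉ K} :=
    (ha.1.comp measurable_fst) hK.measurableSet.compl
  have hSb : MeasurableSet {ω : Ωa × Ωb | Gb ω.2 ∉ K'} :=
    (hb.1.comp measurable_snd) hK'.measurableSet.compl
  have hmeasa : (νa.prod νb).real {ω : Ωa × Ωb | Ga ω.1 ∉ K} ≤ ε / (4 * M) := by
    refine ENNReal.toReal_le_of_le_ofReal hpos.le (le_trans (le_of_eq ?_) hKle)
    exact measurePreserving_fst.measure_preimage
      (s := {ω | Ga ω ∉ K}) (ha.1 hK.measurableSet.compl).nullMeasurableSet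
  have hmeasb : (νa.prod νb).real {ω : Ωa × Ωb | Gb ω.2 ∉ K'} ≤ ε / (4 * M) := by
    refine ENNReal.toReal_le_of_le_ofReal hpos.le (le_trans (le_of_eq ?_) hKle')
    exact measurePreserving_snd.measure_preimage
      (s := {ω | Gb ω ∉ K'}) (hb.1 hK'.measurableSet.compl).nullMeasurableSet
  have hpt : ∀ ω : Ωa × Ωb, H (Ga ω.1, Gb ω.2) ≤ (h (Ga ω.1, Gb ω.2) + η) +
      ({ω : Ωa × Ωb | Ga ω.1 ∉ K}.indicator (fun _ => M) ω +
        {ω : Ωa × Ωb | Gb ω.2 ∉ K'}.indicator (fun _ => M) ω) := fun ω => by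
    have h1 : 0 ≤ {ω : Ωa × Ωb | Ga ω.1 ∉ K}.indicator (fun _ => M) ω :=
      Set.indicator_nonneg (fun _ _ => hM.le) ω
    have h2 : 0 ≤ {ω : Ωa × Ωb | Gb ω.2 ∉ K'}.indicator (fun _ => M) ω :=
      Set.indicator_nonneg (fun _ _ => hM.le) ω
    have h3 := h0 (Ga ω.1, Gb ω.2)
    have h4 : H (Ga ω.1, Gb ω.2) ≤ ‖h‖ + η := hleM _ _
    by_cases hωa : Ga ω.1 ∈ K
    · by_cases hωb : Gb ω.2 ∈ K'
      · have h5 : H (Ga ω.1, Gb ω.2) ≤ _ := hleK _ hωa _ hωb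
        linarith
      · rw [Set.indicator_of_mem (s := {ω : Ωa × Ωb | Gb ω.2 ∉ K'}) hωb]
        linarith
    · rw [Set.indicator_of_mem (s := {ω : Ωa × Ωb | Ga ω.1 ∉ K}) hωa]
      linarith
  have hi1 := h.integrable_comp_borel (ν := νa.prod νb) hG
  have hi2 : Integrable ({ω : Ωa × Ωb | Ga ω.1 ∉ K}.indicator fun _ => M) (νa.prod νb) :=
    (integrable_const M).indicator hSa
  have hi3 : Integrable ({ω : Ωa × Ωb | Gb ω.2 ∉ K'}.indicator fun _ => M) (νa.prod νb) :=
    (integrable_const M).indicator hSb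
  have hmain := (integral_mono (integrable_finsetSum _ fun p _ => hprodi p)
    ((hi1.add (integrable_const η)).add (hi2.add hi3)) hpt).trans_eq
      ((integral_add (hi1.add (integrable_const η)) (hi2.add hi3)).trans
        (congrArg₂ _ (integral_add hi1 (integrable_const η)) (integral_add hi2 hi3)))
  rw [integral_indicator_const _ hSa, integral_indicator_const _ hSb] at hmain
  simp only [integral_const, probReal_univ, smul_eq_mul] at hmain
  have hMε : ε / (4 * M) * M = ε / 4 := by field_simp
  have e1 := mul_le_mul_of_nonneg_right hmeasa hM.le
  have e2 := mul_le_mul_of_nonneg_right hmeasb hM.le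
  have hlt : ∑ p, c p * ((∫ ω, φ p.1 (Ga ω) ∂νa) * ∫ ω, ψ p.2 (Gb ω) ∂νb) <
      ∫ ω, h (Ga ω.1, Gb ω.2) ∂(νa.prod νb) + ε := by
    rw [hHint]
    linarith
  exact (hlim.eventually_lt_const hlt).mono fun i hi => (hupper i).trans hi.le

/-- Maps with values in separable sets are jointly Borel measurable. -/
theorem measurable_borel_prodMk_of_isSeparable {E E' Ωa Ωb : Type*} [MetricSpace E]
    [MetricSpace E'] [MeasurableSpace Ωa] [MeasurableSpace Ωb] {Ga : Ωa → E} {Gb : Ωb → E'}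
    (ha : Measurable[_, borel E] Ga) (hb : Measurable[_, borel E'] Gb) {S : Set E} {S' : Set E'}
    (hS : TopologicalSpace.IsSeparable S) (hS' : TopologicalSpace.IsSeparable S')
    (hGa : ∀ ω, Ga ω ∈ S) (hGb : ∀ ω, Gb ω ∈ S') :
    Measurable[_, borel (E × E')] fun p : Ωa × Ωb => (Ga p.1, Gb p.2) := by
  let _ : MeasurableSpace E := borel E
  have _ : BorelSpace E := ⟨rfl⟩
  let _ : MeasurableSpace E' := borel E'
  have _ : BorelSpace E' := ⟨rfl⟩
  -- For nonseparable spaces the Borel σ-algebra of the product may exceed the product σ-algebra. On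
  -- the second countable `S × S'` they agree, so the pair is factored through it.
  have := hS.separableSpace
  have := hS'.separableSpace
  have := UniformSpace.secondCountable_of_separable S
  have := UniformSpace.secondCountable_of_separable S'
  have hm : Measurable fun p : Ωa × Ωb => ((⟨Ga p.1, hGa p.1⟩ : S), (⟨Gb p.2, hGb p.2⟩ : S')) :=
    ((ha.comp measurable_fst).subtype_mk).prodMk ((hb.comp measurable_snd).subtype_mk)
  have hc : Continuous fun q : S × S' => ((q.1 : E), (q.2 : E')) := by fun_prop
  have hc' : Measurable[_, borel (E × E')] fun q : S × S' => ((q.1 : E), (q.2 : E')) :=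
    hc.borel_measurable.mono (BorelSpace.measurable_eq (α := S × S')).ge le_rfl
  exact hc'.comp hm

end Joint

/-! ### Identification of the limit as a Brownian bridge. -/

section Gaussian

theorem continuous_lInfty_apply {X : Type u} {F : Set (X → ℝ)} (f : F) :
    Continuous fun z : LInfty F => z f :=
  (lp.evalCLM ℝ (fun _ : F => ℝ) ∞ f).continuous

variable {X : Type u} [MeasurableSpace X] {P : Measure X} {F : Set (X → ℝ)}

/-- Puts a linear combination of empirical values into the normalization of the central limit
theorem for the single function `∑ i, c i * f i`. -/
theorem sum_mul_empiricalValue {κ : Type*} [Fintype κ] (f : κ → X → ℝ)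
    (hf : ∀ i, Integrable (f i) P) (c : κ → ℝ) (x : ℕ → X) (n : ℕ) :
    ∑ i, c i * empiricalValue P x n (f i) = (√(n : ℝ))⁻¹ *
      (∑ k ∈ Finset.range n, ∑ i, c i * f i (x k) - n * ∫ y, ∑ i, c i * f i y ∂P) := by
  rw [integral_finsetSum _ fun i _ => (hf i).const_mul (c i), Finset.sum_comm, Finset.mul_sum,
    ← Finset.sum_sub_distrib, Finset.mul_sum]
  refine Finset.sum_congr rfl fun i _ => ?_
  rw [integral_const_mul, ← Finset.mul_sum, empiricalValue]
  rcases Nat.eq_zero_or_pos n with rfl | hn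
  · simp
  have hs : √(n : ℝ) ≠ 0 := by positivity
  have hn' : (n : ℝ) ≠ 0 := by positivity
  have hsq : √(n : ℝ) * √(n : ℝ) = n := Real.mul_self_sqrt (Nat.cast_nonneg n)
  field_simp
  rw [pow_two, hsq]

variable [IsProbabilityMeasure P]

/-- By the central limit theorem, the finite linear combinations of the values of the limit of the
empirical process are centered Gaussian variables. -/
theorem IsDonsker.map_sum_eq_gaussianReal (hF : IsDonsker P F) {Ω' : Type*} [MeasurableSpace Ω']
    {ν : Measure Ω'} [IsProbabilityMeasure ν] {G : Ω' → LInfty F}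
    (hG : WeaklyConverges (Measure.infinitePi fun _ : ℕ => P)
      (fun (n : ℕ) (x : ℕ → X) => empiricalProcess hF.bounded x n) atTop ν G)
    {κ : Type*} [Fintype κ] (f : κ → F) (c : κ → ℝ) :
    ν.map (fun ω => ∑ i, c i * G ω (f i)) =
      gaussianReal 0 Var[fun x => ∑ i, c i * (f i : X → ℝ) x; P].toNNReal := by
  let _ : MeasurableSpace (LInfty F) := borel _
  have _ : BorelSpace (LInfty F) := ⟨rfl⟩
  set g : X → ℝ := fun x => ∑ i, c i * (f i : X → ℝ) x
  have hgm : Measurable g :=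
    Finset.measurable_sum _ fun i _ => (hF.measurable _ (f i).2).const_mul (c i)
  have hgL : MemLp g 2 P := memLp_finsetSum _ fun i _ => (hF.memLp_two _ (f i).2).const_mul (c i)
  have hL : Continuous fun z : LInfty F => ∑ i, c i * z (f i) :=
    continuous_finsetSum _ fun i _ => (continuous_lInfty_apply (f i)).const_mul (c i)
  have hLG : Measurable fun ω => ∑ i, c i * G ω (f i) := hL.measurable.comp hG.1
  have hproj : ∀ k : ℕ, MeasurePreserving (fun x : ℕ → X => x k)
      (Measure.infinitePi fun _ : ℕ => P) P := fun k =>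
    measurePreserving_eval_infinitePi (fun _ : ℕ => P) k
  have hvar : Var[fun x : ℕ → X => g (x 0); Measure.infinitePi fun _ : ℕ => P] = Var[g; P] :=
    (hproj 0).variance_fun_comp hgm.aemeasurable
  have hmean : ∫ x : ℕ → X, g (x 0) ∂(Measure.infinitePi fun _ : ℕ => P) = ∫ y, g y ∂P := by
    have h := integral_map (μ := Measure.infinitePi fun _ : ℕ => P) (f := g)
      (hproj 0).measurable.aemeasurable hgm.aestronglyMeasurable
    rw [(hproj 0).map_eq] at h
    exact h.symm
  have hY : HasLaw (id : ℝ → ℝ) (gaussianReal 0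
      Var[fun x : ℕ → X => g (x 0); Measure.infinitePi fun _ : ℕ => P].toNNReal)
      (gaussianReal 0 Var[g; P].toNNReal) := ⟨aemeasurable_id, by rw [hvar, Measure.map_id]⟩
  have hclt := (tendstoInDistribution_inv_sqrt_mul_sum_sub
    (X := fun k (x : ℕ → X) => g (x k)) hY
    (hgL.comp_measurePreserving (hproj 0))
    (iIndepFun_infinitePi (P := fun _ : ℕ => P) (X := fun _ => g) fun _ => hgm)
    (fun k => ⟨(hgm.comp (hproj k).measurable).aemeasurable,
      (hgm.comp (hproj 0).measurable).aemeasurable, by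
        rw [← Function.comp_def, ← Function.comp_def,
          ← Measure.map_map hgm (hproj k).measurable, ← Measure.map_map hgm (hproj 0).measurable,
          (hproj k).map_eq, (hproj 0).map_eq]⟩)).tendsto
  have hsm : ∀ n : ℕ, Measurable fun x : ℕ → X =>
      (√(n : ℝ))⁻¹ * (∑ k ∈ Finset.range n, g (x k) - n * ∫ y, g y ∂P) := fun n =>
    ((Finset.measurable_sum _ fun k _ => hgm.comp (measurable_pi_apply k)).sub_const _).const_mul _
  have hlin : ∀ (n : ℕ) (x : ℕ → X), ∑ i, c i * empiricalProcess hF.bounded x n (f i) =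
      (√(n : ℝ))⁻¹ * (∑ k ∈ Finset.range n, g (x k) - n * ∫ y, g y ∂P) := fun n x =>
    sum_mul_empiricalValue (fun i => (f i : X → ℝ))
      (fun i => (hF.memLp_two _ (f i).2).integrable (by norm_num)) c x n
  have := Measure.isProbabilityMeasure_map (μ := ν) hLG.aemeasurable
  refine ext_of_forall_integral_eq_of_IsFiniteMeasure fun ψ => ?_
  -- The same sequence has two limits: one from weak convergence tested on `ψ` after a continuous
  -- linear functional, one from the central limit theorem. The outer expectations are ordinary ones
  -- because the finite combinations are measurable.
  have h1 := hG.2 (ψ.compContinuous ⟨_, hL⟩)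
  have h2 := (ProbabilityMeasure.tendsto_iff_forall_integral_tendsto.1 hclt) ψ
  rw [integral_map hLG.aemeasurable ψ.continuous.aestronglyMeasurable]
  refine tendsto_nhds_unique h1 ?_
  simp only [ProbabilityMeasure.coe_mk, Measure.map_id] at h2
  refine h2.congr fun n => ?_
  simp only [BoundedContinuousFunction.compContinuous_apply, ContinuousMap.coe_mk, hlin, hmean]
  rw [integral_map (hsm n).aemeasurable ψ.continuous.aestronglyMeasurable]
  exact (outerExpectation_eq_integral (ψ.continuous.measurable.comp (hsm n))
    fun x => ψ.norm_coe_le_norm _).symm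

/-- The tight limit of the empirical process of a Donsker class is a Brownian bridge. -/
theorem IsDonsker.isBrownianBridge (hF : IsDonsker P F) {Ω' : Type*} [MeasurableSpace Ω']
    {ν : Measure Ω'} [IsProbabilityMeasure ν] {G : Ω' → LInfty F} (ht : IsTightBorel ν G)
    (hG : WeaklyConverges (Measure.infinitePi fun _ : ℕ => P)
      (fun (n : ℕ) (x : ℕ → X) => empiricalProcess hF.bounded x n) atTop ν G) :
    IsBrownianBridge P ν G := by
  let _ : MeasurableSpace (LInfty F) := borel _
  have _ : BorelSpace (LInfty F) := ⟨rfl⟩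
  have hm : ∀ f : F, Measurable fun ω => G ω f := fun f =>
    (continuous_lInfty_apply f).measurable.comp hG.1
  have hlaw : ∀ f : F, ν.map (fun ω => G ω f) =
      gaussianReal 0 Var[(f : X → ℝ); P].toNNReal := fun f => by
    simpa using hF.map_sum_eq_gaussianReal hG (fun _ : Unit => f) fun _ => 1
  have hL2 : ∀ f : F, MemLp (fun ω => G ω f) 2 ν := fun f => by
    have h := memLp_id_gaussianReal (μ := 0) (v := Var[(f : X → ℝ); P].toNNReal) 2
    rw [← hlaw f] at h
    exact h.comp_of_map (hm f).aemeasurable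
  have hmean : ∀ f : F, ∫ ω, G ω f ∂ν = 0 := fun f => by
    have h := integral_id_gaussianReal (μ := 0) (v := Var[(f : X → ℝ); P].toNNReal)
    rwa [← hlaw f, integral_map (hm f).aemeasurable (by fun_prop)] at h
  refine ⟨ht, ⟨fun I => ⟨isGaussian_of_map_eq_gaussianReal fun L => ?_⟩⟩, hmean, fun f g => ?_⟩
  · classical
    -- Cramér–Wold: a functional on `I → ℝ` is the combination of coordinates with weights `L
    -- (Pi.single i 1)`.
    have hL : (L ∘ fun ω => I.restrict fun f => G ω f) =
        fun ω => ∑ i : I, L (Pi.single i 1) * G ω i := by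
      ext ω
      refine (L.toLinearMap.pi_apply_eq_sum_univ _).trans (Finset.sum_congr rfl fun i _ => ?_)
      rw [smul_eq_mul, mul_comm]
      have hi : (fun j : I => if i = j then (1 : ℝ) else 0) = Pi.single i 1 := by
        ext j
        simp [Pi.single_apply, eq_comm]
      exact congrArg (fun v => L v * G ω i) hi
    refine ⟨0, Var[fun x => ∑ i : I, L (Pi.single i 1) * ((i : F) : X → ℝ) x; P].toNNReal, ?_⟩
    have hI : Measurable fun ω => I.restrict fun f => G ω f := measurable_pi_iff.2 fun i => hm i
    rw [Measure.map_map (ContinuousLinearMap.measurable L) hI, hL]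
    exact hF.map_sum_eq_gaussianReal hG (fun i : I => (i : F)) fun i => L (Pi.single i 1)
  · have hf2 := hF.memLp_two _ f.2
    have hg2 := hF.memLp_two _ g.2
    -- Polarization: the variances agree for `s = 1` and `s = -1`, and their difference is four
    -- times the covariance.
    have hv : ∀ s : ℝ, Var[fun ω => G ω f + s * G ω g; ν] =
        Var[fun x => (f : X → ℝ) x + s * (g : X → ℝ) x; P] := fun s => by
      have h := hF.map_sum_eq_gaussianReal hG (fun i : Bool => cond i g f) fun i => cond i s 1
      simp only [Fintype.sum_bool, cond_true, cond_false, one_mul, add_comm (s * _)] at h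
      have hmeas : AEMeasurable (fun ω => G ω f + s * G ω g) ν :=
        ((hm f).add ((hm g).const_mul s)).aemeasurable
      rw [← variance_id_map hmeas, h, variance_id_gaussianReal, Real.coe_toNNReal _ (variance_nonneg _ _)]
    have h1 := hv 1
    have h2 := hv (-1)
    simp only [one_mul, neg_one_mul, ← sub_eq_add_neg] at h1 h2
    rw [variance_fun_add (hL2 f) (hL2 g), variance_fun_add hf2 hg2] at h1
    rw [variance_fun_sub (hL2 f) (hL2 g), variance_fun_sub hf2 hg2] at h2
    have h3 := covariance_eq_sub (hL2 f) (hL2 g)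
    have h4 := covariance_eq_sub hf2 hg2
    rw [hmean, hmean, mul_zero, sub_zero] at h3
    simp only [Pi.mul_apply] at h3 h4
    linarith

end Gaussian

theorem mainTheorem5 {X : Type u} [MeasurableSpace X]
    (Pa Pb : Measure X) [IsProbabilityMeasure Pa] [IsProbabilityMeasure Pb]
    (F : Set (X → ℝ)) (hFa : IsDonsker Pa F) (hFb : IsDonsker Pb F)
    {Ω : Type*} [MeasurableSpace Ω] (μ : Measure Ω) [IsProbabilityMeasure μ]
    (Ya Yb : ℕ → Ω → X)
    (hYa_meas : ∀ i, Measurable (Ya i)) (hYb_meas : ∀ i, Measurable (Yb i))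
    (hYa_law : ∀ i, μ.map (Ya i) = Pa) (hYb_law : ∀ i, μ.map (Yb i) = Pb)
    (hYa_indep : iIndepFun Ya μ) (hYb_indep : iIndepFun Yb μ)
    (hYab_indep : IndepFun (fun ω i => Ya i ω) (fun ω i => Yb i ω) μ)
    {ι : Type*} (l : Filter ι) (na nb : ι → ℕ)
    (hna : Tendsto na l atTop) (hnb : Tendsto nb l atTop)
    (lam : ℝ) (hlam : Tendsto (fun k => (na k : ℝ) / (nb k : ℝ)) l (𝓝 lam)) :
    ∃ (Ω' : Type u) (_ : MeasurableSpace Ω') (ν : Measure Ω') (_ : IsProbabilityMeasure ν)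
      (Ga Gb : Ω' → LInfty F),
      IsBrownianBridge Pa ν Ga ∧
      IsBrownianBridge Pb ν Gb ∧
      @IndepFun Ω' (LInfty F) (LInfty F) _ (borel (LInfty F)) (borel (LInfty F)) Ga Gb ν ∧
      WeaklyConverges μ (fun k ω => empiricalProcess hFa.bounded (fun i => Ya i ω) (na k)) l
        ν Ga ∧
      WeaklyConverges μ (fun k ω => empiricalProcess hFb.bounded (fun i => Yb i ω) (nb k)) l
        ν Gb ∧
      WeaklyConverges μ
        (fun k ω => (empiricalProcess hFa.bounded (fun i => Ya i ω) (na k),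
          empiricalProcess hFb.bounded (fun i => Yb i ω) (nb k))) l
        ν (fun ω' => (Ga ω', Gb ω')) := by
  have hA : MeasurePreserving (fun ω i => Ya i ω) μ (Measure.infinitePi fun _ : ℕ => Pa) :=
    ⟨measurable_pi_lambda _ hYa_meas, by
      simpa [hYa_law] using hYa_indep.map_fun_eq_infinitePi_map hYa_meas⟩
  have hB : MeasurePreserving (fun ω i => Yb i ω) μ (Measure.infinitePi fun _ : ℕ => Pb) :=
    ⟨measurable_pi_lambda _ hYb_meas, by
      simpa [hYb_law] using hYb_indep.map_fun_eq_infinitePi_map hYb_meas⟩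
  obtain ⟨Ωa, _, νa, _, Ga₀, hta₀, hwa₀⟩ := hFa.tight_limit
  obtain ⟨Ωb, _, νb, _, Gb₀, htb₀, hwb₀⟩ := hFb.tight_limit
  -- Separably valued versions are needed for the pair to be Borel measurable in `LInfty F × LInfty
  -- F`.
  obtain ⟨Ga, hGa, hGa_ae, S, hS, hGaS⟩ := hta₀.exists_ae_eq_isSeparable
  obtain ⟨Gb, hGb, hGb_ae, T, hT, hGbT⟩ := htb₀.exists_ae_eq_isSeparable
  have hta := hta₀.congr hGa hGa_ae
  have htb := htb₀.congr hGb hGb_ae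
  have hwa := hwa₀.limit_congr hGa hGa_ae
  have hwb := hwb₀.limit_congr hGb hGb_ae
  have hfst : MeasurePreserving Prod.fst (νa.prod νb) νa := measurePreserving_fst
  have hsnd : MeasurePreserving Prod.snd (νa.prod νb) νb := measurePreserving_snd
  have hwa' := hwa.limit_comp_measurePreserving hfst
  have hwb' := hwb.limit_comp_measurePreserving hsnd
  have h1 := hFa.isBrownianBridge (hta.comp_measurePreserving hfst) hwa'
  have h2 := hFb.isBrownianBridge (htb.comp_measurePreserving hsnd) hwb'
  have h4 := (hwa'.comp_measurePreserving hA).comp_tendsto hna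
  have h5 := (hwb'.comp_measurePreserving hB).comp_tendsto hnb
  have h6 := (hwa.comp_tendsto hna).prodMk hA hB hYab_indep (hwb.comp_tendsto hnb) hta htb
      (measurable_borel_prodMk_of_isSeparable hGa hGb hS hT hGaS hGbT)
  refine ⟨Ωa × Ωb, inferInstance, νa.prod νb, inferInstance, fun p => Ga p.1, fun p => Gb p.2,
    h1, h2, ?_, h4, h5, h6⟩
  let _ : MeasurableSpace (LInfty F) := borel _
  exact indepFun_prod hGa hGb
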